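/- Throughout, graphs are finite, simple and undirected (not necessarily connected). A cograph is a graph with no induced path on four vertices. A cotree of a graph $G=(V,E)$ is a finite rooted tree $T$ whose set of leaves is $V$, in which every inner (non-leaf) vertex has at least two children and carries a label $0$ or $1$, such that for every inner vertex $t$ the subgraph of $G$ induced by the leaves below $t$ is the disjoint union (if $t$ has label $0$) or the join (if $t$ has label $1$) of the subgraphs of $G$ induced by the leaves below the individual children of $t$. The cotree is alternating if the labels of the inner vertices alternate along every root-leaf path, i.e. an inner vertex and an inner child of it always have different labels; a cograph with at least one vertex has such a cotree, and it is unique up to isomorphism. **Lemma.** Let $G=(V,E)$ be a cograph and let $T$ be its alternating cotree. Then a map $\varphi\colon V\to V$ is an automorphism of $G$ if and only if there exists an automorphism $\psi$ of the rooted tree $T$ (a graph automorphism of $T$ fixing the root) which preserves the $0/1$-labels of the inner vertices and satisfies $\psi|_V=\varphi$. -/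

import Mathlib

universe u w

/-- A graph is a cograph if it does not contain an induced path on four vertices. -/
def IsCograph {V : Type u} (G : SimpleGraph V) : Prop :=
  ¬ (SimpleGraph.pathGraph 4).IsIndContained G

/-- A cotree of the graph `G`: a finite rooted tree whose leaves are identified with the vertices
of `G` and whose inner vertices carry a label 0 or 1, such that, for every inner vertex `t`, the
subgraph of `G` induced by the leaves below `t` is the union (label 0) or the join (label 1) of the
subgraphs induced by the leaves below the children of `t`.

Rooted trees are given by their ancestor order: the root is `⊥`, `s ≤ t` means that `s` is
an ancestor of `t` (or `s = t`), `s ⋖ t` means that `t` is a child of `s`, and the leaves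
are the maximal elements. -/
structure Cotree {V : Type u} (G : SimpleGraph V) where
  /-- the underlying rooted tree -/
  tree : RootedTree.{w}
  /-- the tree is finite -/
  finite : Finite tree
  /-- the vertices of `G` are the leaves of the tree -/
  leaf : V ≃ {t : tree // IsMax t}
  /-- the labels of the inner vertices; the values at leaves carry no meaning and are never used -/
  label : tree → Fin 2
  /-- every inner vertex has at least two children -/
  two_children : ∀ t : tree, ¬ IsMax t → ∃ c d : tree, t ⋖ c ∧ t ⋖ d ∧ c ≠ d
  /-- an inner vertex labelled 0 represents the union of the graphs of its children -/
  union : ∀ t : tree, ¬ IsMax t → label t = 0 → ∀ c d : tree, t ⋖ c → t ⋖ d → c ≠ d →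
    ∀ x y : V, c ≤ (leaf x : tree) → d ≤ (leaf y : tree) → ¬ G.Adj x y
  /-- an inner vertex labelled 1 represents the join of the graphs of its children -/
  join : ∀ t : tree, ¬ IsMax t → label t = 1 → ∀ c d : tree, t ⋖ c → t ⋖ d → c ≠ d →
    ∀ x y : V, c ≤ (leaf x : tree) → d ≤ (leaf y : tree) → G.Adj x y

namespace Cotree

/-- The labels alternate along every path from the root to a leaf. -/
def IsAlternating {V : Type u} {G : SimpleGraph V} (T : Cotree.{u, w} G) : Prop :=
  ∀ s t : T.tree, s ⋖ t → ¬ IsMax t → T.label s ≠ T.label t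

/-- The graph underlying the rooted tree: its edges join each vertex to its children. -/
def graph {V : Type u} {G : SimpleGraph V} (T : Cotree.{u, w} G) : SimpleGraph T.tree :=
  SimpleGraph.hasse T.tree

/-- A label-preserving automorphism of the cotree: an automorphism of the underlying graph which
fixes the root and preserves the labels of the inner vertices. -/
structure LabelAut {V : Type u} {G : SimpleGraph V} (T : Cotree.{u, w} G) where
  /-- the bijection of the tree vertices, which preserves edges in both directions -/
  toIso : T.graph ≃g T.graph
  /-- the root is fixed -/
  map_root : toIso ⊥ = ⊥
  /-- labels of inner vertices are preserved -/
  map_label : ∀ t : T.tree, ¬ IsMax t → T.label (toIso t) = T.label t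

end Cotree

/-! Two leaves are adjacent exactly when their least common ancestor has label 1 (`adj_iff_label`),
so a tree automorphism preserving labels preserves adjacency on the leaves. Conversely, alternation
makes the leaf sets of the children of `t` the components of the graph on the leaves below `t`
(label 0) or of its complement (label 1). A graph automorphism that carries the leaves below `s`
onto those below `t` therefore permutes these pieces, and induction from the root gives every tree
vertex an image (`exists_corresponds`). Vertices are determined by their leaf sets, so this is an
order automorphism. -/

namespace Cotree

variable {V : Type u} {G : SimpleGraph V} (T : Cotree.{u, w} G)

/-! ### Children and meets in the rooted tree -/

section Tree

variable {T}

theorem covBy_unique {s c d a : T.tree} (hc : s ⋖ c) (hd : s ⋖ d) (hca : c ≤ a) (hda : d ≤ a) :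
    c = d := by
  rcases le_total_of_directed hca hda with h | h
  · exact ((hc.eq_or_eq hd.le h).resolve_left hd.ne').symm
  · exact (hd.eq_or_eq hc.le h).resolve_left hc.ne'

theorem parent_unique {s t c : T.tree} (hs : s ⋖ c) (ht : t ⋖ c) : s = t := by
  rw [← hs.pred_eq, ← ht.pred_eq]

theorem exists_child_le {s t : T.tree} (h : s < t) : ∃ c, s ⋖ c ∧ c ≤ t :=
  have := T.finite
  exists_covBy_le_of_lt h

theorem exists_parent {t : T.tree} (h : t ≠ ⊥) : ∃ p, p ⋖ t :=
  ⟨Order.pred t, Order.pred_covBy_of_not_isMin (by simpa using h)⟩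

theorem not_isMax_of_covBy {s t : T.tree} (h : s ⋖ t) : ¬ IsMax s :=
  fun hs => hs.not_lt h.lt

theorem inf_eq_of_covBy {s c d a b : T.tree} (hc : s ⋖ c) (hd : s ⋖ d) (hcd : c ≠ d)
    (hca : c ≤ a) (hdb : d ≤ b) : a ⊓ b = s := by
  by_contra hne
  have hle : s ≤ a ⊓ b := le_inf (hc.le.trans hca) (hd.le.trans hdb)
  obtain ⟨e, he, hea⟩ := exists_child_le (lt_of_le_of_ne hle (Ne.symm hne))
  have h₁ := covBy_unique hc he hca (hea.trans inf_le_left)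
  have h₂ := covBy_unique hd he hdb (hea.trans inf_le_right)
  exact hcd (h₁.trans h₂.symm)

theorem exists_other_child {s c : T.tree} (hc : s ⋖ c) : ∃ d, s ⋖ d ∧ c ≠ d := by
  obtain ⟨d, e, hd, he, hde⟩ := T.two_children s (not_isMax_of_covBy hc)
  by_cases h : c = d
  · exact ⟨e, he, h ▸ hde⟩
  · exact ⟨d, hd, h⟩

end Tree

/-- The vertex of the tree corresponding to a vertex of the graph. -/
def node (x : V) : T.tree := (T.leaf x : T.tree)

variable {T}

theorem isMax_node (x : V) : IsMax (T.node x) := (T.leaf x).2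

theorem node_injective : Function.Injective T.node :=
  Subtype.val_injective.comp T.leaf.injective

theorem exists_node_eq {t : T.tree} (h : IsMax t) : ∃ x, T.node x = t :=
  ⟨T.leaf.symm ⟨t, h⟩, by simp [node]⟩

theorem exists_le_node (t : T.tree) : ∃ x, t ≤ T.node x := by
  have := T.finite
  obtain ⟨m, htm, hm⟩ := (Set.toFinite (Set.univ : Set T.tree)).exists_le_maximal (Set.mem_univ t)
  obtain ⟨x, rfl⟩ := exists_node_eq (t := m) (fun b hb => hm.2 (Set.mem_univ b) hb)
  exact ⟨x, htm⟩

theorem node_le_node {x y : V} : T.node x ≤ T.node y ↔ x = y :=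
  ⟨fun h => node_injective ((isMax_node x).eq_of_le h), fun h => h ▸ le_rfl⟩

theorem ne_of_covBy {s c d : T.tree} {x y : V} (hc : s ⋖ c) (hd : s ⋖ d) (hcd : c ≠ d)
    (hx : c ≤ T.node x) (hy : d ≤ T.node y) : x ≠ y := by
  rintro rfl
  exact hcd (covBy_unique hc hd hx hy)

theorem inf_node_lt {x y : V} (h : x ≠ y) : T.node x ⊓ T.node y < T.node x :=
  inf_le_left.lt_of_ne fun e => h (node_le_node.1 (inf_eq_left.1 e))

theorem exists_children_of_ne {x y : V} (h : x ≠ y) :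
    ∃ c d, T.node x ⊓ T.node y ⋖ c ∧ T.node x ⊓ T.node y ⋖ d ∧ c ≠ d ∧
      c ≤ T.node x ∧ d ≤ T.node y := by
  obtain ⟨c, hc, hcx⟩ := exists_child_le (inf_node_lt (T := T) h)
  obtain ⟨d, hd, hdy⟩ := exists_child_le (inf_comm (T.node y) _ ▸ inf_node_lt (T := T) h.symm)
  refine ⟨c, d, hc, hd, ?_, hcx, hdy⟩
  rintro rfl
  exact hc.lt.not_ge (le_inf hcx hdy)

theorem adj_iff_label {x y : V} (h : x ≠ y) :
    G.Adj x y ↔ T.label (T.node x ⊓ T.node y) = 1 := by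
  obtain ⟨c, d, hc, hd, hcd, hcx, hdy⟩ := exists_children_of_ne (T := T) h
  have hs := not_isMax_of_covBy hc
  constructor
  · intro hadj
    by_contra hl
    exact T.union _ hs (by lia) c d hc hd hcd x y hcx hdy hadj
  · intro hl
    exact T.join _ hs hl c d hc hd hcd x y hcx hdy

theorem label_map (g : G ≃g G) {x y : V} (h : x ≠ y) :
    T.label (T.node (g x) ⊓ T.node (g y)) = T.label (T.node x ⊓ T.node y) := by
  have h₁ := adj_iff_label (T := T) h
  have h₂ := adj_iff_label (T := T) (g.injective.ne h)
  rw [g.map_adj_iff, h₁] at h₂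
  lia

/-- If `t < s`, a second child of `t`, off the path to `s`, has a leaf that is not below `s`. -/
theorem le_of_forall_le_node {s t : T.tree} (h : ∀ x, t ≤ T.node x → s ≤ T.node x) : s ≤ t := by
  obtain ⟨x, hx⟩ := exists_le_node t
  rcases lt_or_le_of_directed hx (h x hx) with hts | hst
  swap
  · exact hst
  obtain ⟨c, hc, hcs⟩ := exists_child_le hts
  obtain ⟨d, hd, hcd⟩ := exists_other_child hc
  obtain ⟨y, hy⟩ := exists_le_node d
  exact absurd (covBy_unique hc hd (hcs.trans (h y (hd.le.trans hy))) hy) hcd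

/-- Two vertices are equal or joined by a path of length at most two whose vertices lie below `t`
and whose edges are the pairs whose least common ancestor has a label different from that
of `t`. -/
def Linked (T : Cotree.{u, w} G) (t : T.tree) (x y : V) : Prop :=
  x = y ∨ T.label (T.node x ⊓ T.node y) ≠ T.label t ∨
    ∃ z, t ≤ T.node z ∧ z ≠ x ∧ z ≠ y ∧ T.label (T.node x ⊓ T.node z) ≠ T.label t ∧
      T.label (T.node z ⊓ T.node y) ≠ T.label t

theorem child_le_of_label_ne {t c : T.tree} {x y : V} (hc : t ⋖ c) (hx : c ≤ T.node x)
    (hy : t ≤ T.node y) (h : T.label (T.node x ⊓ T.node y) ≠ T.label t) : c ≤ T.node y := by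
  have hlt : t < T.node x ⊓ T.node y :=
    (le_inf (hc.le.trans hx) hy).lt_of_ne fun e => h (by rw [← e])
  obtain ⟨d, hd, hdx⟩ := exists_child_le hlt
  rw [covBy_unique hc hd hx (hdx.trans inf_le_left)]
  exact hdx.trans inf_le_right

/-- Describes the leaves of a child through labels of meets alone, which graph automorphisms
preserve. -/
theorem child_le_iff (hT : T.IsAlternating) {t c : T.tree} {x : V} (hc : t ⋖ c)
    (hx : c ≤ T.node x) (y : V) : c ≤ T.node y ↔ t ≤ T.node y ∧ T.Linked t x y := by
  constructor
  · intro hy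
    refine ⟨hc.le.trans hy, or_iff_not_imp_left.2 fun hxy => ?_⟩
    have hle : c ≤ T.node x ⊓ T.node y := le_inf hx hy
    have hcm : ¬ IsMax c := fun h => (hle.trans_lt (inf_node_lt hxy)).not_ge (h hx)
    have hl : T.label c ≠ T.label t := (hT t c hc hcm).symm
    rcases hle.eq_or_lt with he | hlt
    · exact Or.inl (he ▸ hl)
    obtain ⟨d, hd, hdle⟩ := exists_child_le hlt
    -- Both `x` and `y` lie below the child `d` of `c`; a leaf `z` below another child meets each of
    -- them in `c`.
    obtain ⟨e, he, hde⟩ := exists_other_child hd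
    obtain ⟨z, hz⟩ := exists_le_node e
    have hdx := hdle.trans inf_le_left
    have hdy := hdle.trans inf_le_right
    refine Or.inr ⟨z, hc.le.trans (he.le.trans hz), (ne_of_covBy hd he hde hdx hz).symm,
      (ne_of_covBy hd he hde hdy hz).symm, ?_, ?_⟩
    · rwa [inf_eq_of_covBy hd he hde hdx hz]
    · rwa [inf_eq_of_covBy he hd hde.symm hz hdy]
  · rintro ⟨hy, rfl | h | ⟨z, hz, -, -, h₁, h₂⟩⟩
    · exact hx
    · exact child_le_of_label_ne hc hx hy h
    · exact child_le_of_label_ne hc (child_le_of_label_ne hc hx hz h₁) hy h₂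

/-- The automorphism `g` of the graph maps the leaves below `s` onto the leaves below `t`. -/
def Corresponds (T : Cotree.{u, w} G) (g : G ≃g G) (s t : T.tree) : Prop :=
  ∀ x, s ≤ T.node x ↔ t ≤ T.node (g x)

theorem Corresponds.not_isMax {g : G ≃g G} {s t : T.tree} (h : T.Corresponds g s t)
    (hs : ¬ IsMax s) : ¬ IsMax t := by
  intro ht
  obtain ⟨c, d, hc, hd, hcd⟩ := T.two_children s hs
  obtain ⟨x, hx⟩ := exists_le_node c
  obtain ⟨y, hy⟩ := exists_le_node d
  have h₁ := ht.eq_of_le ((h x).1 (hc.le.trans hx))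
  have h₂ := ht.eq_of_le ((h y).1 (hd.le.trans hy))
  exact ne_of_covBy hc hd hcd hx hy (g.injective (node_injective (h₁.symm.trans h₂)))

/-- A graph and its complement cannot both be disconnected. -/
theorem Corresponds.label_eq {g : G ≃g G} {s t : T.tree} (h : T.Corresponds g s t)
    (hs : ¬ IsMax s) : T.label t = T.label s := by
  by_contra hne
  obtain ⟨c, d, hc, hd, hcd⟩ := T.two_children s hs
  obtain ⟨x, hx⟩ := exists_le_node c
  obtain ⟨y, hy⟩ := exists_le_node d
  have hxy := ne_of_covBy hc hd hcd hx hy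
  have hlab : T.label (T.node (g x) ⊓ T.node (g y)) = T.label s := by
    rw [label_map g hxy, inf_eq_of_covBy hc hd hcd hx hy]
  have hle : t ≤ T.node (g x) ⊓ T.node (g y) :=
    le_inf ((h x).1 (hc.le.trans hx)) ((h y).1 (hd.le.trans hy))
  -- The images of `x` and `y` share a child of `t`; a leaf from another child then links `x` to `y`
  -- inside one child of `s`.
  obtain ⟨a, ha, hale⟩ := exists_child_le (hle.lt_of_ne fun e => hne (e ▸ hlab))
  obtain ⟨b, hb, hab⟩ := exists_other_child ha
  obtain ⟨z, hz⟩ := exists_le_node b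
  obtain ⟨z, rfl⟩ := g.surjective z
  have hax := hale.trans inf_le_left
  have hay := hale.trans inf_le_right
  have hzx : x ≠ z := fun e => ne_of_covBy ha hb hab hax hz (congrArg g e)
  have hzy : z ≠ y := fun e => ne_of_covBy ha hb hab hay hz (congrArg g e.symm)
  have h₁ : c ≤ T.node z := child_le_of_label_ne hc hx ((h z).2 (hb.le.trans hz)) (by
    rwa [← label_map g hzx, inf_eq_of_covBy ha hb hab hax hz])
  have h₂ : c ≤ T.node y := child_le_of_label_ne hc h₁ (hd.le.trans hy) (by
    rwa [← label_map g hzy, inf_eq_of_covBy hb ha hab.symm hz hay])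
  exact hcd (covBy_unique hc hd h₂ hy)

theorem Corresponds.linked_iff {g : G ≃g G} {s t : T.tree} (h : T.Corresponds g s t)
    (hs : ¬ IsMax s) (x y : V) : T.Linked s x y ↔ T.Linked t (g x) (g y) := by
  by_cases hxy : x = y
  · simp [Linked, hxy]
  have hex : (∃ z, s ≤ T.node z ∧ z ≠ x ∧ z ≠ y ∧ T.label (T.node x ⊓ T.node z) ≠ T.label s ∧
      T.label (T.node z ⊓ T.node y) ≠ T.label s) ↔
      ∃ z, t ≤ T.node z ∧ z ≠ g x ∧ z ≠ g y ∧ T.label (T.node (g x) ⊓ T.node z) ≠ T.label s ∧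
        T.label (T.node z ⊓ T.node (g y)) ≠ T.label s := by
    rw [g.surjective.exists (p := fun z => t ≤ T.node z ∧ _)]
    refine exists_congr fun z => and_congr (h z) ?_
    rw [g.injective.ne_iff, g.injective.ne_iff]
    refine and_congr_right fun hzx => and_congr_right fun hzy => ?_
    rw [label_map g hzx.symm, label_map g hzy]
  rw [Linked, Linked, h.label_eq hs, label_map g hxy, g.injective.eq_iff, hex]

theorem exists_corresponds (hT : T.IsAlternating) (g : G ≃g G) (s : T.tree) :
    ∃ t, T.Corresponds g s t := by
  have := T.finite
  induction s using WellFoundedLT.induction with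
  | ind s ih =>
    by_cases hs : s = ⊥
    · exact ⟨⊥, fun x => by simp [hs]⟩
    obtain ⟨p, hp⟩ := exists_parent hs
    obtain ⟨q, hq⟩ := ih p hp.lt
    have hpm := not_isMax_of_covBy hp
    obtain ⟨x, hx⟩ := exists_le_node s
    have hqx : q < T.node (g x) :=
      ((hq x).1 (hp.le.trans hx)).lt_of_ne fun e => hq.not_isMax hpm (e ▸ isMax_node _)
    obtain ⟨t, ht, htx⟩ := exists_child_le hqx
    refine ⟨t, fun y => ?_⟩
    rw [child_le_iff hT hp hx, child_le_iff hT ht htx, hq y, hq.linked_iff hpm]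

theorem Corresponds.le_iff {g : G ≃g G} {s t s' t' : T.tree} (hs : T.Corresponds g s s')
    (ht : T.Corresponds g t t') : s' ≤ t' ↔ s ≤ t := by
  constructor <;> intro h <;> refine le_of_forall_le_node fun x hx => ?_
  · exact (hs x).2 (h.trans ((ht x).1 hx))
  · obtain ⟨x, rfl⟩ := g.surjective x
    exact (hs x).1 (h.trans ((ht x).2 hx))

theorem Corresponds.unique {g : G ≃g G} {s t t' : T.tree} (h : T.Corresponds g s t)
    (h' : T.Corresponds g s t') : t = t' :=
  le_antisymm ((h.le_iff h').2 le_rfl) ((h'.le_iff h).2 le_rfl)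

theorem Corresponds.symm {g : G ≃g G} {s t : T.tree} (h : T.Corresponds g s t) :
    T.Corresponds g.symm t s := fun x => by
  simpa using (h (g.symm x)).symm

theorem corresponds_node (g : G ≃g G) (x : V) :
    T.Corresponds g (T.node x) (T.node (g x)) := fun y => by
  simp [node_le_node]

/-- An automorphism of the graph induces an automorphism of the tree order. -/
theorem exists_orderIso (hT : T.IsAlternating) (g : G ≃g G) :
    ∃ F : T.tree ≃o T.tree, ∀ t, T.Corresponds g t (F t) := by
  choose f hf using exists_corresponds hT g
  choose f' hf' using exists_corresponds hT g.symm
  exact ⟨{ toFun := f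
           invFun := f'
           left_inv := fun t => (hf' (f t)).unique (hf t).symm
           right_inv := fun t => (hf (f' t)).unique (hf' t).symm
           map_rel_iff' := fun {s t} => (hf s).le_iff (hf t) }, hf⟩

/-- Working down from the fixed root: a reversed edge would give the image of `s` two parents, the
images of `t` and of the parent of `s`. -/
theorem LabelAut.covBy (ψ : T.LabelAut) {s t : T.tree} (h : s ⋖ t) :
    ψ.toIso s ⋖ ψ.toIso t := by
  have := T.finite
  induction s using WellFoundedLT.induction generalizing t with
  | ind s ih =>
    have hadj : T.graph.Adj (ψ.toIso s) (ψ.toIso t) := ψ.toIso.map_adj_iff.2 (Or.inl h)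
    refine hadj.resolve_right fun hts => ?_
    by_cases hs : s = ⊥
    · rw [hs, ψ.map_root] at hts
      exact not_lt_bot hts.lt
    obtain ⟨p, hp⟩ := exists_parent hs
    have hpt : p = t := ψ.toIso.injective (parent_unique (ih p hp.lt hp) hts)
    exact (hp.lt.trans h.lt).ne hpt

theorem LabelAut.covBy_iff (ψ : T.LabelAut) {s t : T.tree} :
    ψ.toIso s ⋖ ψ.toIso t ↔ s ⋖ t := by
  refine ⟨fun h => ?_, ψ.covBy⟩
  have hadj : T.graph.Adj s t := ψ.toIso.map_adj_iff.1 (Or.inl h)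
  exact hadj.resolve_right fun hts => h.lt.asymm (ψ.covBy hts).lt

theorem monotone_of_covBy {f : T.tree → T.tree} (hf : ∀ s t, s ⋖ t → f s ⋖ f t) :
    Monotone f := by
  have := T.finite
  intro s t h
  induction t using WellFoundedLT.induction with
  | ind t ih =>
    rcases h.eq_or_lt with rfl | hlt
    · exact le_rfl
    obtain ⟨p, hsp, hp⟩ := exists_le_covBy_of_lt hlt
    exact (ih p hp.lt hsp).trans (hf p t hp).le

/-- An automorphism of the graph of a cotree which fixes the root preserves the tree order. -/
def LabelAut.orderIso (ψ : T.LabelAut) : T.tree ≃o T.tree :=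
  ψ.toIso.toEquiv.toOrderIso (monotone_of_covBy fun _ _ h => ψ.covBy h)
    (monotone_of_covBy fun s t h => by
      rw [← ψ.covBy_iff]
      change ψ.toIso (ψ.toIso.symm s) ⋖ ψ.toIso (ψ.toIso.symm t)
      rwa [RelIso.apply_symm_apply, RelIso.apply_symm_apply])

@[simp]
theorem LabelAut.orderIso_apply (ψ : T.LabelAut) (t : T.tree) : ψ.orderIso t = ψ.toIso t := rfl

/-- An order automorphism of a cotree which preserves the labels of the inner vertices. -/
def labelAutOfOrderIso (F : T.tree ≃o T.tree)
    (hF : ∀ t, ¬ IsMax t → T.label (F t) = T.label t) : T.LabelAut where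
  toIso := { toEquiv := F.toEquiv
             map_rel_iff' := by simp [graph, apply_covBy_apply_iff] }
  map_root := F.map_bot
  map_label := hF

theorem LabelAut.adj_iff (ψ : T.LabelAut) {φ : V → V}
    (hφ : ∀ v, ψ.toIso (T.node v) = T.node (φ v)) (hinj : Function.Injective φ) (x y : V) :
    G.Adj (φ x) (φ y) ↔ G.Adj x y := by
  by_cases h : x = y
  · simp [h]
  obtain ⟨c, -, hc, -⟩ := exists_children_of_ne (T := T) h
  rw [adj_iff_label (T := T) h, adj_iff_label (T := T) (hinj.ne h), ← hφ, ← hφ,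
    ← ψ.orderIso_apply, ← ψ.orderIso_apply, ← map_inf, ψ.orderIso_apply,
    ψ.map_label _ (not_isMax_of_covBy hc)]

end Cotree

theorem lemma5p7 {V : Type u} [Finite V] (G : SimpleGraph V) (hG : IsCograph G)
    (T : Cotree.{u, w} G) (hT : T.IsAlternating) (φ : V → V) :
    (∃ g : G ≃g G, ∀ v : V, g v = φ v) ↔
      ∃ ψ : T.LabelAut, ∀ v : V, ψ.toIso (T.leaf v : T.tree) = (T.leaf (φ v) : T.tree) := by
  constructor
  · rintro ⟨g, hg⟩
    obtain ⟨F, hF⟩ := Cotree.exists_orderIso hT g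
    refine ⟨Cotree.labelAutOfOrderIso F fun t ht => (hF t).label_eq ht, fun v => ?_⟩
    rw [← hg]
    exact (hF (T.node v)).unique (Cotree.corresponds_node g v)
  · rintro ⟨ψ, hψ⟩
    have hinj : Function.Injective φ := fun x y h =>
      Cotree.node_injective (T := T) (ψ.toIso.injective
        ((hψ x).trans ((congrArg T.node h).trans (hψ y).symm)))
    exact ⟨{ toEquiv := Equiv.ofBijective φ (Finite.injective_iff_bijective.1 hinj)
             map_rel_iff' := fun {x y} => ψ.adj_iff hψ hinj x y }, fun _ => rfl⟩
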